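/- Let $d,n\ge 0$ be integers and let $f:\mathbb{R}^d\to\mathbb{C}$ be a continuous function which solves the $d$-dimensional Popoviciu equation $$\det\bigl[f(x+(i+j)h)\bigr]_{0\le i,j\le n}=0\qquad\text{for all } x,h\in\mathbb{R}^d .$$ Then the restriction of $f$ to any line is an exponential polynomial: for all $x_0,h_0\in\mathbb{R}^d$ there exist $s\ge 0$, polynomials $P_1,\dots,P_s\in\mathbb{C}[t]$ and numbers $\mu_1,\dots,\mu_s\in\mathbb{C}$ such that $$f(x_0+th_0)=\sum_{k=1}^{s}P_k(t)\,e^{\mu_k t}\qquad\text{for all } t\in\mathbb{R}.$$ -/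

import Mathlib

/-- `f : ℝᵈ → ℂ` solves the `d`-dimensional Popoviciu equation of index `n`: for all `x, h ∈ ℝᵈ`
the `(n + 1) × (n + 1)` Hankel matrix with entries `f (x + (i + j) h)`, `0 ≤ i, j ≤ n`,
is singular. -/
def IsPopoviciuSolution (d n : ℕ) (f : EuclideanSpace ℝ (Fin d) → ℂ) : Prop :=
  ∀ x h : EuclideanSpace ℝ (Fin d),
    (Matrix.of fun i j : Fin (n + 1) => f (x + ((i : ℕ) + (j : ℕ) : ℝ) • h)).det = 0

/-- `F : ℝ → ℂ` is an exponential polynomial: a finite sum `∑ P_k(t) e^{μ_k t}` with complex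
polynomials `P_k` and complex frequencies `μ_k`. -/
def IsExponentialPolynomial (F : ℝ → ℂ) : Prop :=
  ∃ (s : ℕ) (P : Fin s → Polynomial ℂ) (μ : Fin s → ℂ),
    ∀ t : ℝ, F t = ∑ k : Fin s, (P k).eval (t : ℂ) * Complex.exp (μ k * (t : ℂ))

/-! Restricted to a line, the equation says that each sequence `m ↦ F (m / N)` has vanishing Hankel
determinants of size `n + 1`. A nonsingular Hankel block of maximal size propagates in both
directions, which yields a two-sided recurrence of order at most `n`
(`exists_recurrence_of_det_hankelAt_eq_zero`). So the kernel `F (x + y)` has rank at most `n` on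
every lattice, hence on ℝ by continuity (`det_add_eq_zero_of_det_hankel_eq_zero`).

A maximal nonzero minor then gives a vector `G` of translates of `F` with `G (x + y) = M x G y`.
Integrating in `x` shows that `G` is smooth enough to solve `G' = A G` (`exists_hasDerivAt_mulVec`),
and Cayley–Hamilton reduces this system to scalar first-order equations. -/

/-- The value at `m` of the linear difference operator with coefficients `c 0, …, c (r - 1)`. -/
def shiftSum {K : Type*} [Field K] (a : ℤ → K) (c : ℕ → K) (r : ℕ) (m : ℤ) : K :=
  ∑ j ∈ Finset.range r, c j * a (m + j)

/-- The `r × r` Hankel matrix of the sequence `a` starting at `m`. -/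
def hankelAt {K : Type*} [Field K] (a : ℤ → K) (r : ℕ) (m : ℤ) : Matrix (Fin r) (Fin r) K :=
  Matrix.of fun i j => a (m + (i : ℕ) + (j : ℕ))

/-! ### Hankel determinants and two-sided linear recurrences -/

section Sequences

variable {K : Type*} [Field K] {a : ℤ → K} {r : ℕ} {m : ℤ}

theorem shiftSum_succ (a : ℤ → K) (c : ℕ → K) (r : ℕ) (m : ℤ) :
    shiftSum a c (r + 1) m = shiftSum a c r m + c r * a (m + r) :=
  Finset.sum_range_succ _ _

theorem shiftSum_succ' (a : ℤ → K) (c : ℕ → K) (r : ℕ) (m : ℤ) :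
    shiftSum a c (r + 1) m = shiftSum a (fun j => c (j + 1)) r (m + 1) + c 0 * a m := by
  simp only [shiftSum, Finset.sum_range_succ', Nat.cast_zero, add_zero]
  congr 1
  refine Finset.sum_congr rfl fun j _ => ?_
  push_cast
  ring_nf

theorem shiftSum_congr {c e : ℕ → K} (h : ∀ j < r, c j = e j) :
    shiftSum a c r m = shiftSum a e r m :=
  Finset.sum_congr rfl fun j hj => by rw [h j (Finset.mem_range.1 hj)]

theorem shiftSum_const_mul (c : ℕ → K) (x : K) :
    shiftSum a (fun j => x * c j) r m = x * shiftSum a c r m := by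
  simp only [shiftSum, Finset.mul_sum, mul_assoc]

theorem shiftSum_sub (c e : ℕ → K) :
    shiftSum a (fun j => c j - e j) r m = shiftSum a c r m - shiftSum a e r m := by
  simp only [shiftSum, ← Finset.sum_sub_distrib, sub_mul]

theorem det_hankelAt_eq_zero_iff :
    (hankelAt a r m).det = 0 ↔
      ∃ c : ℕ → K, (∃ j < r, c j ≠ 0) ∧ ∀ i < r, shiftSum a c r (m + (i : ℕ)) = 0 := by
  rw [← Matrix.exists_mulVec_eq_zero_iff]
  constructor
  · rintro ⟨v, hv, h⟩
    refine ⟨fun j => if hj : j < r then v ⟨j, hj⟩ else 0, ?_, fun i hi => ?_⟩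
    · obtain ⟨j, hj⟩ := Function.ne_iff.1 hv
      exact ⟨j, j.2, by simpa using hj⟩
    · have := congrFun h ⟨i, hi⟩
      simp only [Matrix.mulVec, dotProduct, hankelAt, Matrix.of_apply, Pi.zero_apply] at this
      rw [shiftSum, Finset.sum_range, ← this]
      refine Finset.sum_congr rfl fun j _ => ?_
      simp [mul_comm]
  · rintro ⟨c, ⟨j, hj, hc⟩, h⟩
    refine ⟨fun j => c j, Function.ne_iff.2 ⟨⟨j, hj⟩, hc⟩, funext fun i => ?_⟩
    have := h i i.2
    rw [shiftSum, Finset.sum_range] at this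
    simp only [Matrix.mulVec, dotProduct, hankelAt, Matrix.of_apply, Pi.zero_apply]
    rw [← this]
    refine Finset.sum_congr rfl fun j _ => ?_
    rw [mul_comm]

theorem eq_zero_of_det_hankelAt_ne_zero (hm : (hankelAt a r m).det ≠ 0) {c : ℕ → K}
    (hc : ∀ i < r, shiftSum a c r (m + (i : ℕ)) = 0) {j : ℕ} (hj : j < r) : c j = 0 := by
  by_contra h
  exact hm (det_hankelAt_eq_zero_iff.2 ⟨c, ⟨j, hj, h⟩, hc⟩)

/-- Next to a nonsingular Hankel matrix of size `r`, the recurrences of order `r` are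
proportional. -/
theorem mul_eq_mul_of_shiftSum_eq_zero (hm : (hankelAt a r m).det ≠ 0) {c e : ℕ → K}
    (hc : ∀ i < r, shiftSum a c (r + 1) (m + (i : ℕ)) = 0)
    (he : ∀ i < r, shiftSum a e (r + 1) (m + (i : ℕ)) = 0) {j : ℕ} (hj : j < r + 1) :
    e r * c j = c r * e j := by
  rcases Nat.lt_succ_iff_lt_or_eq.1 hj with hj | rfl
  · refine sub_eq_zero.1 (eq_zero_of_det_hankelAt_ne_zero hm
      (c := fun j => e r * c j - c r * e j) (fun i hi => ?_) hj)
    have h1 := hc i hi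
    have h2 := he i hi
    rw [shiftSum_succ] at h1 h2
    rw [shiftSum_sub, shiftSum_const_mul, shiftSum_const_mul]
    linear_combination e r * h1 - c r * h2
  · exact mul_comm _ _

theorem shiftSum_eq_zero_of_proportional {c e : ℕ → K} (hr : e r ≠ 0)
    (h : ∀ j < r + 1, e r * c j = c r * e j) (he : shiftSum a e (r + 1) m = 0) :
    shiftSum a c (r + 1) m = 0 := by
  have := shiftSum_congr (a := a) (m := m) h
  rw [shiftSum_const_mul, shiftSum_const_mul, he, mul_zero] at this
  exact (mul_eq_zero.1 this).resolve_left hr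

/-- The local recurrence around a nonsingular Hankel matrix. -/
theorem exists_local_recurrence (h : ∀ m, (hankelAt a (r + 1) m).det = 0)
    (hm : (hankelAt a r m).det ≠ 0) :
    ∃ c : ℕ → K, c 0 ≠ 0 ∧ c r ≠ 0 ∧
      (∀ i < r + 2, shiftSum a c (r + 1) (m - 1 + (i : ℕ)) = 0) ∧
      (hankelAt a r (m + 1)).det ≠ 0 ∧ (hankelAt a r (m - 1)).det ≠ 0 := by
  have last_ne : ∀ c : ℕ → K, (∃ j < r + 1, c j ≠ 0) →
      (∀ i < r, shiftSum a c (r + 1) (m + (i : ℕ)) = 0) → c r ≠ 0 := by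
    rintro c ⟨j, hj, hcj⟩ hc h0
    rcases Nat.lt_succ_iff_lt_or_eq.1 hj with hj | rfl
    · refine hcj (eq_zero_of_det_hankelAt_ne_zero hm (fun i hi => ?_) hj)
      simpa [shiftSum_succ, h0] using hc i hi
    · exact hcj h0
  obtain ⟨c, hc0, hc⟩ := det_hankelAt_eq_zero_iff.1 (h m)
  obtain ⟨e, he0, he⟩ := det_hankelAt_eq_zero_iff.1 (h (m - 1))
  have hc' : ∀ i < r, shiftSum a c (r + 1) (m + (i : ℕ)) = 0 := fun i hi => hc i (by lia)
  have he' : ∀ i < r, shiftSum a e (r + 1) (m + (i : ℕ)) = 0 := fun i hi => by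
    have := he (i + 1) (by lia)
    rwa [show m - 1 + ((i + 1 : ℕ) : ℤ) = m + i by push_cast; ring] at this
  have hcr := last_ne c hc0 hc'
  have her := last_ne e he0 he'
  -- `c` and `e` share the windows `m, …, m + r - 1`, hence are proportional; `e` adds the window `m
  -- - 1` and `c` the window `m + r`.
  have hall : ∀ i < r + 2, shiftSum a c (r + 1) (m - 1 + (i : ℕ)) = 0 := by
    intro i hi
    rcases Nat.lt_succ_iff_lt_or_eq.1 hi with hi | rfl
    · exact shiftSum_eq_zero_of_proportional her
        (fun j hj => mul_eq_mul_of_shiftSum_eq_zero hm hc' he' hj) (he i hi)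
    · rw [show m - 1 + ((r + 1 : ℕ) : ℤ) = m + r by push_cast; ring]
      exact hc r (by lia)
  have hc00 : c 0 ≠ 0 := by
    intro h0
    cases r with
    | zero => exact hcr h0
    | succ k =>
      refine hcr (eq_zero_of_det_hankelAt_ne_zero hm (c := fun j => c (j + 1))
        (fun i hi => ?_) (Nat.lt_succ_self k))
      have := hall i (by lia)
      rw [shiftSum_succ', h0, zero_mul, add_zero] at this
      rwa [show m - 1 + (i : ℤ) + 1 = m + i by ring] at this
  refine ⟨c, hc00, hcr, hall, fun hdet => ?_, fun hdet => ?_⟩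
  · obtain ⟨b, ⟨j, hj, hbj⟩, hb⟩ := det_hankelAt_eq_zero_iff.1 hdet
    -- Prefixed by a zero, `b` becomes a recurrence on the windows of `c`, hence a multiple of `c`;
    -- as `c 0 ≠ 0`, it vanishes.
    set b' : ℕ → K := fun j => if j = 0 then 0 else b (j - 1) with hb'
    have hk : ∀ i < r, shiftSum a b' (r + 1) (m + (i : ℕ)) = 0 := fun i hi => by
      rw [shiftSum_succ']
      simpa [hb', add_right_comm] using hb i hi
    have hp := fun {j : ℕ} (hj : j < r + 1) => mul_eq_mul_of_shiftSum_eq_zero hm hc' hk hj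
    have h0 : b' r = 0 := by
      have := hp (j := 0) (by lia)
      simpa [hb', hc00] using this
    have h1 := hp (j := j + 1) (by lia)
    rw [h0, zero_mul] at h1
    have h2 := (mul_eq_zero.1 h1.symm).resolve_left hcr
    exact hbj (by simpa [hb'] using h2)
  · obtain ⟨b, ⟨j, hj, hbj⟩, hb⟩ := det_hankelAt_eq_zero_iff.1 hdet
    refine hbj (eq_zero_of_det_hankelAt_ne_zero hm (fun i hi => ?_) hj)
    by_cases hir : i + 1 < r
    · have := hb (i + 1) hir
      rwa [show m - 1 + ((i + 1 : ℕ) : ℤ) = m + i by push_cast; ring] at this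
    · have hi' : i + 1 = r := by lia
      -- Only the window `m + r - 1` is missing for `b`. The sequence `shiftSum a b r` obeys the
      -- recurrence `c` at `m - 1` and has `r` zeros from there, so its next term is zero too.
      have key : ∑ l ∈ Finset.range (r + 1), c l * shiftSum a b r (m - 1 + (l : ℕ)) = 0 := by
        have hswap : ∑ l ∈ Finset.range (r + 1), c l * shiftSum a b r (m - 1 + (l : ℕ)) =
            ∑ q ∈ Finset.range r, b q * shiftSum a c (r + 1) (m - 1 + (q : ℕ)) := by
          simp only [shiftSum, Finset.mul_sum]
          rw [Finset.sum_comm]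
          refine Finset.sum_congr rfl fun q _ => Finset.sum_congr rfl fun l _ => ?_
          rw [add_right_comm (m - 1) (l : ℤ)]
          ring
        rw [hswap]
        refine Finset.sum_eq_zero fun q hq => ?_
        rw [hall q (by have := Finset.mem_range.1 hq; lia), mul_zero]
      rw [Finset.sum_range_succ, Finset.sum_eq_zero, zero_add] at key
      · have := (mul_eq_zero.1 key).resolve_left hcr
        rwa [show m - 1 + (r : ℤ) = m + i by rw [← hi']; push_cast; ring] at this
      · intro l hl
        rw [hb l (Finset.mem_range.1 hl), mul_zero]

/-- If all Hankel determinants of size `r + 1` vanish and one of size `r` does not, then the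
sequence satisfies a two-sided linear recurrence of order `r`. -/
theorem exists_global_recurrence (h : ∀ m, (hankelAt a (r + 1) m).det = 0)
    (hm : (hankelAt a r m).det ≠ 0) :
    ∃ c : ℕ → K, c 0 ≠ 0 ∧ c r ≠ 0 ∧ ∀ k, shiftSum a c (r + 1) k = 0 := by
  obtain ⟨c, hc0, hcr, hc, -⟩ := exists_local_recurrence h hm
  have transfer : ∀ p : ℤ, (hankelAt a r p).det ≠ 0 →
      (∀ i < r, shiftSum a c (r + 1) (p + (i : ℕ)) = 0) →
      ∀ i < r + 2, shiftSum a c (r + 1) (p - 1 + (i : ℕ)) = 0 := by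
    intro p hp hk i hi
    obtain ⟨e, -, her, he, -⟩ := exists_local_recurrence h hp
    refine shiftSum_eq_zero_of_proportional her
      (fun j hj => mul_eq_mul_of_shiftSum_eq_zero hp hk (fun q hq => ?_) hj) (he i hi)
    have := he (q + 1) (by lia)
    rwa [show p - 1 + ((q + 1 : ℕ) : ℤ) = p + q by push_cast; ring] at this
  have main : ∀ k : ℤ, (hankelAt a r (m + k)).det ≠ 0 ∧
      ∀ i < r + 2, shiftSum a c (r + 1) (m + k - 1 + (i : ℕ)) = 0 := by
    intro k
    induction k using Int.induction_on with
    | zero => simpa using ⟨hm, hc⟩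
    | succ k ih =>
      obtain ⟨-, -, -, -, hnd, -⟩ := exists_local_recurrence h ih.1
      rw [add_assoc] at hnd
      refine ⟨hnd, transfer _ hnd fun i hi => ?_⟩
      -- The `r` windows from `m + k + 1` are the last of the `r + 2` windows from `m + k - 1`.
      have := ih.2 (i + 2) (by lia)
      rwa [show m + (k : ℤ) - 1 + ((i + 2 : ℕ) : ℤ) = m + (k + 1) + i by push_cast; ring] at this
    | pred k ih =>
      obtain ⟨-, -, -, -, -, hnd⟩ := exists_local_recurrence h ih.1
      rw [add_sub_assoc] at hnd
      refine ⟨hnd, transfer _ hnd fun i hi => ?_⟩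
      have := ih.2 i (by lia)
      rwa [show m + (-(k : ℤ)) - 1 + (i : ℤ) = m + (-k - 1) + i by ring] at this
  refine ⟨c, hc0, hcr, fun k => ?_⟩
  have := (main (k - m + 1)).2 0 (by lia)
  rwa [show m + (k - m + 1) - 1 + ((0 : ℕ) : ℤ) = k by push_cast; ring] at this

/-- A sequence all of whose consecutive Hankel determinants of size `n + 1` vanish satisfies a
two-sided linear recurrence of order at most `n`. -/
theorem exists_recurrence_of_det_hankelAt_eq_zero {n : ℕ}
    (h : ∀ m, (hankelAt a (n + 1) m).det = 0) :
    ∃ r ≤ n, ∃ c : ℕ → K, c 0 ≠ 0 ∧ c r ≠ 0 ∧ ∀ k, shiftSum a c (r + 1) k = 0 := by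
  induction n with
  | zero =>
    exact ⟨0, le_rfl, exists_global_recurrence (m := 0) h (by simp)⟩
  | succ n ih =>
    by_cases h' : ∀ m, (hankelAt a (n + 1) m).det = 0
    · obtain ⟨r, hr, hc⟩ := ih h'
      exact ⟨r, by lia, hc⟩
    · obtain ⟨m, hm⟩ := not_forall.1 h'
      exact ⟨n + 1, le_rfl, exists_global_recurrence h hm⟩

/-- A solution of a two-sided recurrence of order `r` with `r` consecutive zeros vanishes. -/
theorem eq_zero_of_recurrence {c : ℕ → K} (h0 : c 0 ≠ 0) (hr : c r ≠ 0)
    (h : ∀ k, shiftSum a c (r + 1) k = 0) (hz : ∀ i < r, a (i : ℕ) = 0) (k : ℤ) : a k = 0 := by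
  have main : ∀ k : ℤ, ∀ i < r, a (k + (i : ℕ)) = 0 := by
    intro k
    induction k using Int.induction_on with
    | zero => simpa using hz
    | succ k ih =>
      intro i hi
      by_cases hir : i + 1 < r
      · have := ih (i + 1) hir
        rwa [show (k : ℤ) + ((i + 1 : ℕ) : ℤ) = k + 1 + i by push_cast; ring] at this
      · have hi' : i + 1 = r := by lia
        have h1 := h k
        rw [shiftSum_succ, shiftSum, Finset.sum_eq_zero fun j hj => by
          rw [ih j (Finset.mem_range.1 hj), mul_zero], zero_add] at h1
        have := (mul_eq_zero.1 h1).resolve_left hr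
        rwa [show (k : ℤ) + (r : ℤ) = k + 1 + i by rw [← hi']; push_cast; ring] at this
    | pred k ih =>
      intro i hi
      cases i with
      | succ i =>
        have := ih i (by lia)
        rwa [show -(k : ℤ) + (i : ℤ) = -k - 1 + ((i + 1 : ℕ) : ℤ) by push_cast; ring] at this
      | zero =>
        have h1 := h (-k - 1)
        rw [shiftSum_succ', shiftSum, Finset.sum_eq_zero fun j hj => by
          rw [sub_add_cancel, ih j (Finset.mem_range.1 hj), mul_zero], zero_add] at h1
        simpa using (mul_eq_zero.1 h1).resolve_left h0
  rcases Nat.eq_zero_or_pos r with rfl | hpos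
  · simpa [shiftSum, h0] using h k
  · simpa using main k 0 hpos

/-- If all consecutive Hankel determinants of size `n + 1` vanish, then so do all determinants
of size `n + 1` of the kernel `(k, l) ↦ a (k + l)`. -/
theorem det_add_eq_zero_of_det_hankelAt_eq_zero {n : ℕ}
    (h : ∀ m, (hankelAt a (n + 1) m).det = 0) (k l : Fin (n + 1) → ℤ) :
    (Matrix.of fun i j => a (k i + l j)).det = 0 := by
  obtain ⟨r, hr, c, h0, hcr, hc⟩ := exists_recurrence_of_det_hankelAt_eq_zero h
  -- As `r < n + 1`, some nontrivial combination of the `n + 1` translates vanishes at `0, …, r -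
  -- 1`; by the recurrence it vanishes everywhere.
  obtain ⟨g, hg, hg0⟩ : ∃ g : Fin (n + 1) → K, g ≠ 0 ∧
      (Matrix.of fun (q : Fin r) i => a (k i + (q : ℕ))).mulVec g = 0 := by
    have hker := LinearMap.ker_ne_bot_of_finrank_lt
      (f := Matrix.mulVecLin (Matrix.of fun (q : Fin r) i => a (k i + (q : ℕ)))) (by simp; lia)
    obtain ⟨g, hg, hg0⟩ := (Submodule.ne_bot_iff _).1 hker
    exact ⟨g, hg0, by simpa using hg⟩
  rw [← Matrix.exists_vecMul_eq_zero_iff]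
  refine ⟨g, hg, funext fun j => ?_⟩
  have := eq_zero_of_recurrence (a := fun p => ∑ i, g i * a (k i + p)) h0 hcr (fun p => ?_)
    (fun i hi => ?_) (l j)
  · simpa [Matrix.vecMul, dotProduct] using this
  · simp only [shiftSum, Finset.mul_sum]
    rw [Finset.sum_comm]
    refine Finset.sum_eq_zero fun i _ => ?_
    have h1 := hc (k i + p)
    rw [shiftSum] at h1
    rw [← mul_zero (g i), ← h1, Finset.mul_sum]
    refine Finset.sum_congr rfl fun j _ => ?_
    rw [add_assoc]
    ring
  · have := congrFun hg0 ⟨i, hi⟩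
    simpa [Matrix.mulVec, dotProduct, mul_comm] using this

end Sequences

/-! ### Exponential polynomials and linear differential equations -/

theorem IsExponentialPolynomial.add {F G : ℝ → ℂ} (hF : IsExponentialPolynomial F)
    (hG : IsExponentialPolynomial G) : IsExponentialPolynomial fun t => F t + G t := by
  obtain ⟨s, P, μ, hF⟩ := hF
  obtain ⟨s', P', μ', hG⟩ := hG
  refine ⟨s + s', Fin.append P P', Fin.append μ μ', fun t => ?_⟩
  simp [Fin.sum_univ_add, hF t, hG t]

theorem isExponentialPolynomial_const (c : ℂ) : IsExponentialPolynomial fun _ => c :=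
  ⟨1, fun _ => Polynomial.C c, fun _ => 0, fun t => by simp⟩

theorem IsExponentialPolynomial.mul_exp {F : ℝ → ℂ} (hF : IsExponentialPolynomial F) (l : ℂ) :
    IsExponentialPolynomial fun t => F t * Complex.exp (l * (t : ℂ)) := by
  obtain ⟨s, P, μ, hF⟩ := hF
  refine ⟨s, P, fun k => μ k + l, fun t => ?_⟩
  simp only [hF t, Finset.sum_mul, add_mul, Complex.exp_add, mul_assoc]

open Polynomial in
theorem exists_derivative_eq (P : ℂ[X]) : ∃ Q : ℂ[X], derivative Q = P := by
  induction P using Polynomial.induction_on' with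
  | add p q hp hq =>
    obtain ⟨p', rfl⟩ := hp
    obtain ⟨q', rfl⟩ := hq
    exact ⟨p' + q', by simp⟩
  | monomial n c =>
    refine ⟨monomial (n + 1) (c / (n + 1)), ?_⟩
    rw [derivative_monomial]
    have : ((n : ℂ) + 1) ≠ 0 := Nat.cast_add_one_ne_zero n
    simp [div_mul_cancel₀ _ this]

open Polynomial in
theorem exists_derivative_add_C_mul_eq (μ : ℂ) (P : ℂ[X]) :
    ∃ Q : ℂ[X], derivative Q + C μ * Q = P := by
  by_cases hμ : μ = 0
  · obtain ⟨Q, hQ⟩ := exists_derivative_eq P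
    exact ⟨Q, by simp [hμ, hQ]⟩
  · have hC : (C μ * C μ⁻¹ : ℂ[X]) = 1 := by rw [← C_mul, mul_inv_cancel₀ hμ, C_1]
    have main : ∀ (k : ℕ) (P : ℂ[X]), derivative^[k] P = 0 →
        ∃ Q : ℂ[X], derivative Q + C μ * Q = P := by
      intro k
      induction k with
      | zero => intro P hP; exact ⟨0, by simpa using hP.symm⟩
      | succ k ih =>
        intro P hP
        obtain ⟨R, hR⟩ := ih (derivative P) (by simpa using hP)
        -- From `R' + μ R = P'`, the choice `μ Q = P - R` gives `Q' = R`.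
        refine ⟨C μ⁻¹ * (P - R), ?_⟩
        rw [derivative_C_mul, derivative_sub, ← hR]
        linear_combination P * hC
    exact main _ P (iterate_derivative_eq_zero (Nat.lt_succ_self P.natDegree))

theorem IsExponentialPolynomial.exists_hasDerivAt {F : ℝ → ℂ} (hF : IsExponentialPolynomial F) :
    ∃ G : ℝ → ℂ, IsExponentialPolynomial G ∧ ∀ t, HasDerivAt G (F t) t := by
  obtain ⟨s, P, μ, hF⟩ := hF
  choose Q hQ using fun k => exists_derivative_add_C_mul_eq (μ k) (P k)
  refine ⟨fun t => ∑ k, (Q k).eval (t : ℂ) * Complex.exp (μ k * (t : ℂ)), ⟨s, Q, μ, fun _ => rfl⟩,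
    fun t => ?_⟩
  rw [hF t]
  refine HasDerivAt.fun_sum fun k _ => ?_
  have h1 : HasDerivAt (fun z : ℂ => (Q k).eval z * Complex.exp (μ k * z))
      ((P k).eval (t : ℂ) * Complex.exp (μ k * (t : ℂ))) (t : ℂ) := by
    refine (((Q k).hasDerivAt (t : ℂ)).mul
      (((hasDerivAt_id (t : ℂ)).const_mul (μ k)).cexp)).congr_deriv ?_
    rw [← hQ k]
    simp only [Polynomial.eval_add, Polynomial.eval_mul, Polynomial.eval_C, id, mul_one]
    ring
  exact h1.comp_ofReal

/-- A solution of `F' - l F = G` with `G` an exponential polynomial is one too. -/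
theorem IsExponentialPolynomial.of_hasDerivAt {F G : ℝ → ℂ} {l : ℂ}
    (hG : IsExponentialPolynomial G) (hF : ∀ t, HasDerivAt F (l * F t + G t) t) :
    IsExponentialPolynomial F := by
  obtain ⟨H, hH, hHd⟩ := (hG.mul_exp (-l)).exists_hasDerivAt
  have hE : ∀ t : ℝ, HasDerivAt (fun t : ℝ => Complex.exp (-l * (t : ℂ)))
      (Complex.exp (-l * (t : ℂ)) * -l) t := fun t => by
    have : HasDerivAt (fun z : ℂ => Complex.exp (-l * z)) (Complex.exp (-l * (t : ℂ)) * -l) t := by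
      simpa using ((hasDerivAt_id (t : ℂ)).const_mul (-l)).cexp
    exact this.comp_ofReal
  have hd : ∀ t, HasDerivAt (fun t : ℝ => F t * Complex.exp (-l * (t : ℂ)) - H t) 0 t := fun t => by
    refine (((hF t).mul (hE t)).sub (hHd t)).congr_deriv ?_
    ring
  have hconst : ∀ t, F t * Complex.exp (-l * (t : ℂ)) - H t = F 0 - H 0 := fun t => by
    simpa using is_const_of_deriv_eq_zero (fun t => (hd t).differentiableAt)
      (fun t => (hd t).deriv) t 0
  have := (hH.add (isExponentialPolynomial_const (F 0 - H 0))).mul_exp l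
  convert this using 2 with t
  rw [← hconst t, add_sub_cancel, mul_assoc, ← Complex.exp_add]
  simp

/-- The coordinates of the solutions of a linear system `G' = A G` with constant coefficients are
exponential polynomials. -/
theorem isExponentialPolynomial_dotProduct {ι : Type*} [Fintype ι] [DecidableEq ι]
    {A : Matrix ι ι ℂ} {G : ℝ → ι → ℂ} (hG : ∀ t, HasDerivAt G (A.mulVec (G t)) t) (w : ι → ℂ) :
    IsExponentialPolynomial fun t => dotProduct w (G t) := by
  have hd : ∀ (w : ι → ℂ) (t : ℝ), HasDerivAt (fun t => dotProduct w (G t))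
      (dotProduct (Matrix.vecMul w A) (G t)) t := fun w t => by
    rw [← Matrix.dotProduct_mulVec]
    exact HasDerivAt.fun_sum fun i _ => ((hasDerivAt_pi.1 (hG t)) i).const_mul (w i)
  -- Each factor `A - l` is peeled off as a scalar equation for `w ⬝ G`, with forcing term `w (A -
  -- l) ⬝ G`.
  have main : ∀ (s : Multiset ℂ) (w : ι → ℂ),
      Matrix.vecMul w (Polynomial.aeval A (s.map fun l => Polynomial.X - Polynomial.C l).prod) = 0 →
      IsExponentialPolynomial fun t => dotProduct w (G t) := by
    intro s
    induction s using Multiset.induction with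
    | empty =>
      intro w hw
      have : w = 0 := by simpa using hw
      simpa [this] using isExponentialPolynomial_const 0
    | cons l s ih =>
      intro w hw
      refine (ih (Matrix.vecMul w (A - algebraMap ℂ _ l)) ?_).of_hasDerivAt (l := l) fun t => ?_
      · rw [Matrix.vecMul_vecMul, ← hw]
        simp
      · convert hd w t using 1
        rw [Matrix.vecMul_sub, sub_dotProduct, Matrix.algebraMap_eq_diagonal]
        have : Matrix.vecMul w (Matrix.diagonal (algebraMap ℂ (ι → ℂ) l)) = l • w := by
          ext i
          simp [Matrix.vecMul_diagonal, mul_comm]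
        rw [this, smul_dotProduct, smul_eq_mul]
        ring
  refine main A.charpoly.roots w ?_
  rw [← (IsAlgClosed.splits A.charpoly).eq_prod_roots_of_monic A.charpoly_monic,
    Matrix.aeval_self_charpoly, Matrix.vecMul_zero]

/-! ### From lattices to the line: the finite-rank kernel -/

theorem tendsto_int_floor_mul_natCast_div_atTop (x : ℝ) :
    Filter.Tendsto (fun N : ℕ => (⌊x * N⌋ : ℝ) / N) Filter.atTop (nhds x) := by
  have hl : Filter.Tendsto (fun N : ℕ => x - 1 / (N : ℝ)) Filter.atTop (nhds x) := by
    simpa using tendsto_const_nhds.sub (tendsto_one_div_atTop_nhds_zero_nat (𝕜 := ℝ))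
  refine tendsto_of_tendsto_of_tendsto_of_le_of_le' hl tendsto_const_nhds ?_ ?_ <;>
    filter_upwards [Filter.eventually_gt_atTop 0] with N hN <;>
    have hN' : (0 : ℝ) < N := Nat.cast_pos.2 hN
  · rw [le_div_iff₀ hN', sub_mul, one_div_mul_cancel hN'.ne']
    exact (Int.sub_one_lt_floor _).le
  · rw [div_le_iff₀ hN']
    exact Int.floor_le _

section Kernel

variable {F : ℝ → ℂ}

/-- For a continuous function on the line, the Popoviciu equation forces all determinants of size
`n + 1` of the kernel `(x, y) ↦ F (x + y)` to vanish. -/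
theorem det_add_eq_zero_of_det_hankel_eq_zero (hF : Continuous F) {n : ℕ}
    (h : ∀ x h : ℝ, (Matrix.of fun i j : Fin (n + 1) =>
      F (x + ((i : ℕ) + (j : ℕ) : ℝ) * h)).det = 0) (u v : Fin (n + 1) → ℝ) :
    (Matrix.of fun i j => F (u i + v j)).det = 0 := by
  have hlim := tendsto_int_floor_mul_natCast_div_atTop
  have h1 : Filter.Tendsto
      (fun N : ℕ => (Matrix.of fun i j => F ((⌊u i * N⌋ : ℝ) / N + (⌊v j * N⌋ : ℝ) / N)).det)
      Filter.atTop (nhds (Matrix.of fun i j => F (u i + v j)).det) := by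
    refine (Continuous.matrix_det continuous_id).continuousAt.tendsto.comp ?_
    refine tendsto_pi_nhds.2 fun i => tendsto_pi_nhds.2 fun j => ?_
    exact (hF.tendsto _).comp ((hlim (u i)).add (hlim (v j)))
  -- The case `N = 0` is harmless: division by zero gives the constant `F 0`, covered by step zero.
  refine tendsto_nhds_unique h1 (tendsto_const_nhds.congr fun N => ?_)
  have := det_add_eq_zero_of_det_hankelAt_eq_zero (a := fun m : ℤ => F ((m : ℝ) / N)) (n := n)
    (fun m => ?_) (fun i => ⌊u i * N⌋) (fun j => ⌊v j * N⌋)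
  · rw [← this]
    congr 2
    ext i j
    congr 1
    push_cast
    ring
  · rw [← h ((m : ℝ) / N) (1 / N)]
    congr 1
    ext i j
    simp only [hankelAt, Matrix.of_apply]
    congr 1
    push_cast
    ring

theorem exists_det_add_ne_zero_maximal {n : ℕ}
    (h : ∀ u v : Fin (n + 1) → ℝ, (Matrix.of fun i j => F (u i + v j)).det = 0) :
    ∃ (r : ℕ) (u v : Fin r → ℝ), (Matrix.of fun i j => F (u i + v j)).det ≠ 0 ∧
      ∀ u v : Fin (r + 1) → ℝ, (Matrix.of fun i j => F (u i + v j)).det = 0 := by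
  induction n with
  | zero => exact ⟨0, Fin.elim0, Fin.elim0, by simp, h⟩
  | succ n ih =>
    by_cases h' : ∀ u v : Fin (n + 1) → ℝ, (Matrix.of fun i j => F (u i + v j)).det = 0
    · exact ih h'
    · push Not at h'
      obtain ⟨u, v, huv⟩ := h'
      exact ⟨n + 1, u, v, huv, h⟩

/-- The kernel `F (x + y)` is recovered from a nonsingular minor of maximal size. -/
theorem eq_dotProduct_of_det_add_eq_zero {r : ℕ} {u v : Fin r → ℝ}
    (hB : (Matrix.of fun i j => F (u i + v j)).det ≠ 0)
    (h : ∀ u v : Fin (r + 1) → ℝ, (Matrix.of fun i j => F (u i + v j)).det = 0) (x y : ℝ) :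
    F (x + y) = dotProduct
      (Matrix.vecMul (fun j => F (x + v j)) (Matrix.of fun i j => F (u i + v j))⁻¹)
      (fun i => F (u i + y)) := by
  set B : Matrix (Fin r) (Fin r) ℂ := Matrix.of fun i j => F (u i + v j) with hBdef
  have hunit : IsUnit B.det := hB.isUnit
  let _ := Matrix.invertibleOfIsUnitDet B hunit
  let e : Fin r ⊕ Unit ≃ Fin (r + 1) := Fintype.equivOfCardEq (by simp)
  -- Bordering `B` by the row of `x` and the column of `y` gives a singular matrix, so its Schur
  -- complement is zero.
  have hblock : (Matrix.fromBlocks B (Matrix.of fun i (_ : Unit) => F (u i + y))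
      (Matrix.of fun (_ : Unit) j => F (x + v j)) (Matrix.of fun _ _ => F (x + y))).det = 0 := by
    rw [← h (Sum.elim u (fun _ => x) ∘ e.symm) (Sum.elim v (fun _ => y) ∘ e.symm),
      ← Matrix.det_submatrix_equiv_self e]
    congr 1
    ext i j
    rcases i with i | i <;> rcases j with j | j <;> simp [hBdef]
  rw [Matrix.det_fromBlocks₁₁, Matrix.det_unique (n := Unit)] at hblock
  have := (mul_eq_zero.1 hblock).resolve_left hB
  rw [Matrix.sub_apply, sub_eq_zero, Matrix.invOf_eq_nonsing_inv] at this
  exact this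

end Kernel

/-! ### Differentiability from the translation law -/

/-- A continuous vector function whose translates are given by a continuous matrix function
satisfies a linear differential system with constant coefficients. -/
theorem exists_hasDerivAt_mulVec {ι : Type*} [Fintype ι] [DecidableEq ι] {G : ℝ → ι → ℂ}
    {M : ℝ → Matrix ι ι ℂ} (hG : Continuous G) (hM : Continuous M) (h0 : M 0 = 1)
    (h : ∀ x y, G (x + y) = (M x).mulVec (G y)) :
    ∃ A : Matrix ι ι ℂ, ∀ t, HasDerivAt G (A.mulVec (G t)) t := by
  have hMc : ∀ i j, Continuous fun s => M s i j := fun i j => hM.matrix_elem i j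
  have hGc : ∀ i, Continuous fun s => G s i := fun i => (continuous_apply i).comp hG
  let N : ℝ → Matrix ι ι ℂ := fun t => Matrix.of fun i j => ∫ s in (0 : ℝ)..t, M s i j
  -- `N t / t` tends to `M 0 = 1`, so `N t` is invertible for small `t ≠ 0`.
  obtain ⟨t, ht⟩ : ∃ t : ℝ, (N t).det ≠ 0 := by
    have hlim : Filter.Tendsto (fun t : ℝ => ((t : ℝ)⁻¹ • N t).det) (nhdsWithin 0 {0}ᶜ)
        (nhds (1 : Matrix ι ι ℂ).det) := by
      refine (Continuous.matrix_det continuous_id).continuousAt.tendsto.comp ?_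
      refine tendsto_pi_nhds.2 fun i => tendsto_pi_nhds.2 fun j => ?_
      have := (intervalIntegral.integral_hasDerivAt_right
        ((hMc i j).intervalIntegrable 0 0) ((hMc i j).stronglyMeasurableAtFilter _ _)
        (hMc i j).continuousAt).tendsto_slope
      rw [h0] at this
      refine this.congr fun t => ?_
      simp [slope, N]
    rw [Matrix.det_one] at hlim
    obtain ⟨t, ht⟩ := (hlim.eventually_ne one_ne_zero).exists
    refine ⟨t, fun h => ht ?_⟩
    rw [Matrix.det_smul_of_tower, h, smul_zero]
  have hN : ∀ y, (N t).mulVec (G y) = fun i => ∫ s in y..(y + t), G s i := fun y => by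
    ext i
    have h1 : ∫ s in y..(y + t), G s i = ∫ s in (0 : ℝ)..t, G (s + y) i := by
      rw [intervalIntegral.integral_comp_add_right (fun s => G s i), zero_add, add_comm]
    rw [h1]
    simp only [h, Matrix.mulVec, dotProduct, N, Matrix.of_apply]
    rw [intervalIntegral.integral_finsetSum (f := fun j s => M s i j * G y j) fun j _ =>
      ((hMc i j).mul continuous_const).intervalIntegrable _ _]
    simp only [intervalIntegral.integral_mul_const]
  -- `G` is now expressed by integrals of itself, so continuity upgrades to differentiability.
  have hGN : G = fun y => (N t)⁻¹.mulVec fun i => ∫ s in y..(y + t), G s i := by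
    ext1 y
    rw [← hN, Matrix.mulVec_mulVec, Matrix.nonsing_inv_mul _ ht.isUnit, Matrix.one_mulVec]
  have hI : ∀ y, HasDerivAt (fun y => fun i => ∫ s in y..(y + t), G s i)
      (G (y + t) - G y) y := fun y => by
    refine hasDerivAt_pi.2 fun i => ?_
    have hp : ∀ z, HasDerivAt (fun z => ∫ s in (0 : ℝ)..z, G s i) (G z i) z := fun z =>
      intervalIntegral.integral_hasDerivAt_right ((hGc i).intervalIntegrable _ _)
        ((hGc i).stronglyMeasurableAtFilter _ _) (hGc i).continuousAt
    have h1 := ((hp (y + t)).comp_add_const y t).sub (hp y)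
    refine h1.congr_of_eventuallyEq (Filter.Eventually.of_forall fun z => ?_)
    exact (intervalIntegral.integral_interval_sub_left ((hGc i).intervalIntegrable _ _)
      ((hGc i).intervalIntegrable _ _)).symm
  refine ⟨(N t)⁻¹ * (M t - 1), fun y => ?_⟩
  have hd : HasDerivAt (fun y => (N t)⁻¹.mulVec fun i => ∫ s in y..(y + t), G s i)
      ((N t)⁻¹.mulVec (G (y + t) - G y)) y := by
    refine hasDerivAt_pi.2 fun i => ?_
    exact HasDerivAt.fun_sum fun j _ => ((hasDerivAt_pi.1 (hI y)) j).const_mul _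
  rw [← hGN] at hd
  rwa [← Matrix.mulVec_mulVec, Matrix.sub_mulVec, Matrix.one_mulVec, ← h, add_comm t]

/-- A continuous function on the line whose kernel `F (x + y)` has rank at most `n` is an
exponential polynomial. -/
theorem isExponentialPolynomial_of_det_add_eq_zero {F : ℝ → ℂ} (hF : Continuous F) {n : ℕ}
    (h : ∀ u v : Fin (n + 1) → ℝ, (Matrix.of fun i j => F (u i + v j)).det = 0) :
    IsExponentialPolynomial F := by
  obtain ⟨r, u, v, hB, hr⟩ := exists_det_add_ne_zero_maximal h
  have key := eq_dotProduct_of_det_add_eq_zero hB hr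
  set B : Matrix (Fin r) (Fin r) ℂ := Matrix.of fun i j => F (u i + v j) with hBdef
  -- Row `i` of `M x` holds the coefficients from `key` at the point `u i + x`.
  let M : ℝ → Matrix (Fin r) (Fin r) ℂ := fun x => (Matrix.of fun i j => F (u i + x + v j)) * B⁻¹
  obtain ⟨A, hA⟩ := exists_hasDerivAt_mulVec (G := fun y i => F (u i + y)) (M := M)
    (continuous_pi fun i => hF.comp (continuous_const.add continuous_id))
    (Continuous.matrix_mul (continuous_matrix fun i j =>
      hF.comp ((continuous_const.add continuous_id).add continuous_const)) continuous_const)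
    (by simp only [M, add_zero]; exact Matrix.mul_nonsing_inv _ hB.isUnit)
    (fun x y => by
      ext i
      rw [← add_assoc, key]
      rfl)
  convert isExponentialPolynomial_dotProduct hA
    (Matrix.vecMul (fun j => F (0 + v j)) B⁻¹) using 2 with t
  rw [← key, zero_add]

theorem mainTheorem7 (d n : ℕ) (f : EuclideanSpace ℝ (Fin d) → ℂ)
    (hcont : Continuous f) (hf : IsPopoviciuSolution d n f) :
    ∀ x₀ h₀ : EuclideanSpace ℝ (Fin d),
      IsExponentialPolynomial fun t : ℝ => f (x₀ + t • h₀) := by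
  intro x₀ h₀
  have hF : Continuous fun t : ℝ => f (x₀ + t • h₀) :=
    hcont.comp (continuous_const.add (continuous_id.smul continuous_const))
  refine isExponentialPolynomial_of_det_add_eq_zero hF
    (det_add_eq_zero_of_det_hankel_eq_zero hF (n := n) fun x h => ?_)
  rw [← hf (x₀ + x • h₀) (h • h₀)]
  congr 1
  ext i j
  simp only [Matrix.of_apply]
  rw [add_smul x, mul_smul, add_assoc]
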